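/- Let $p$ be a prime, and let $B$ be the quaternion algebra over $\mathbb Q$ that is ramified exactly at $p$ and $\infty$, with reduced norm $\operatorname{nrd}$. An order of $B$ is a subring that is generated as an additive group by a $\mathbb Q$-basis of $B$; it is maximal if no order of $B$ properly contains it. For maximal orders $\mathfrak O,\mathfrak O'\subseteq B$, let $d(\mathfrak O,\mathfrak O')=[\mathfrak O:\mathfrak O\cap\mathfrak O']$ be the index of additive groups. Let $\mathfrak O,\mathfrak O'$ be maximal orders of $B$, let $M$ be a real number, and let $\alpha\in\mathfrak O\setminus\mathbb Z$ and $\alpha'\in\mathfrak O'\setminus\mathbb Z$ satisfy $\operatorname{nrd}(\alpha)\le M$ and $\operatorname{nrd}(\alpha')\le M$. If the quadratic fields $\mathbb Q(\alpha)$ and $\mathbb Q(\alpha')$ are not isomorphic, then $$d(\mathfrak O,\mathfrak O')^2\ \ge\ \frac{p}{4M^2}.$$ -/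

import Mathlib

open scoped Quaternion

namespace QuatOrder

/-- The base change to a field `K` of the rational quaternion algebra `(a, b | ℚ)`
(with `i² = a`, `j² = b`, `ij = -ji = k`) is a division ring. For `K` the completion of `ℚ`
at a place, this says that `(a, b | ℚ)` ramifies at that place. -/
def RamifiedOver (K : Type*) [Field K] [Algebra ℚ K] (a b : ℚ) : Prop :=
  ∀ x : ℍ[K, algebraMap ℚ K a, algebraMap ℚ K b], x ≠ 0 → IsUnit x

/-- The quaternion algebra `(a, b | ℚ)` ramifies exactly at the places `p` and `∞`. -/
structure RamifiedExactlyAt (p : ℕ) [Fact p.Prime] (a b : ℚ) : Prop where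
  left_ne_zero : a ≠ 0
  right_ne_zero : b ≠ 0
  real : RamifiedOver ℝ a b
  padic : RamifiedOver ℚ_[p] a b
  other : ∀ (l : ℕ) [Fact l.Prime], l ≠ p → ¬ RamifiedOver ℚ_[l] a b

variable {a b : ℚ}

/-- The reduced norm `nrd x = x * conj x`, as a rational number. -/
def nrd (x : ℍ[ℚ, a, b]) : ℚ := (x * star x).re

theorem coe_nrd (x : ℍ[ℚ, a, b]) : ((nrd x : ℚ) : ℍ[ℚ, a, b]) = x * star x := by
  ext <;> simp [nrd] <;> ring

theorem nrd_eq (x : ℍ[ℚ, a, b]) :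
    nrd x = x.re ^ 2 - a * x.imI ^ 2 - b * x.imJ ^ 2 + a * b * x.imK ^ 2 := by
  simp [nrd]; ring

/-- An order: a subring whose additive group is generated by a `ℚ`-basis of the algebra. -/
def IsOrder (O : Subring ℍ[ℚ, a, b]) : Prop :=
  ∃ e : Module.Basis (Fin 4) ℚ ℍ[ℚ, a, b], AddSubgroup.closure (Set.range e) = O.toAddSubgroup

/-- A maximal order: an order that no order properly contains. -/
def IsMaximalOrder (O : Subring ℍ[ℚ, a, b]) : Prop := Maximal IsOrder O

/-- The distance `d(O, O')`: the index of `O ∩ O'` in `O` as additive groups. -/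
noncomputable def dist (O O' : Subring ℍ[ℚ, a, b]) : ℕ :=
  (O ⊓ O').toAddSubgroup.relIndex O.toAddSubgroup

end QuatOrder

/-!
Write `N` for the distance `[O : O ∩ O']`. Then `N • α` lies in `O'`, as does `α'`, so it suffices
to compare two elements `x`, `y` of a single order. If the fields `ℚ(α)` and `ℚ(α')` are not
isomorphic then `x = N • α` and `y = α'` do not commute: the centralizer of a non-rational element
is the field it generates (`QuatOrder.mem_adjoin_of_commute`). Their commutator has norm

* a positive integer, because the algebra is ramified at `∞`, hence definite;
* at most `4 nrd x nrd y ≤ 4 N² M²` (`QuatOrder.nrd_commutator_le`);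
* divisible by `p`, because the algebra is ramified at `p` (`QuatOrder.IsOrder.dvd_nrd_commutator`).

Therefore `p ≤ 4 N² M²`.

For the divisibility, the elements of an order with norm divisible by `p` form a two-sided ideal
(`QuatOrder.normIdeal`). Closure under addition is the place where ramification at `p` enters: by
Hensel's lemma an element whose norm is divisible by `p` has trace divisible by `p`, as otherwise
its characteristic polynomial would split over `ℚ_p`. The quotient by this ideal is a finite
domain, hence commutative by Wedderburn's little theorem, so all commutators lie in the ideal.
-/

namespace QuatOrder

open Polynomial

/-! ### Reduced trace and norm -/

theorem nrd_mul (x y : ℍ[ℚ, a, b]) : nrd (x * y) = nrd x * nrd y := by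
  simp only [nrd_eq, QuaternionAlgebra.re_mul, QuaternionAlgebra.imI_mul,
    QuaternionAlgebra.imJ_mul, QuaternionAlgebra.imK_mul]
  ring

theorem nrd_add (x y : ℍ[ℚ, a, b]) : nrd (x + y) = nrd x + nrd y + 2 * (x * star y).re := by
  simp [nrd_eq]
  ring

theorem nrd_star (x : ℍ[ℚ, a, b]) : nrd (star x) = nrd x := by
  simp [nrd_eq]

theorem nrd_one : nrd (1 : ℍ[ℚ, a, b]) = 1 := by
  simp [nrd_eq]

theorem nrd_nsmul (n : ℕ) (x : ℍ[ℚ, a, b]) : nrd (n • x) = n ^ 2 * nrd x := by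
  simp [nrd_eq]
  ring

/-! ### Ramification at infinity -/

/-- Ramification at `∞` forces `a < 0`, as otherwise `√a + i` is a zero divisor over `ℝ`. -/
theorem RamifiedOver.left_neg (h : RamifiedOver ℝ a b) : a < 0 := by
  by_contra hn
  have ha0 : (0 : ℝ) ≤ a := by exact_mod_cast not_lt.mp hn
  have hx : (⟨√a, 1, 0, 0⟩ : ℍ[ℝ, algebraMap ℚ ℝ a, algebraMap ℚ ℝ b]) ≠ 0 := fun h0 ↦ by
    simpa using congrArg QuaternionAlgebra.imI h0
  have h0 := (h _ hx).mul_right_eq_zero (b := ⟨√a, -1, 0, 0⟩)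
  have := congrArg QuaternionAlgebra.imI (h0.mp (by
    ext <;> simp [Real.mul_self_sqrt ha0]))
  simp at this

/-- Ramification at `∞` forces `b < 0`, as otherwise `√b + j` is a zero divisor over `ℝ`. -/
theorem RamifiedOver.right_neg (h : RamifiedOver ℝ a b) : b < 0 := by
  by_contra hn
  have hb0 : (0 : ℝ) ≤ b := by exact_mod_cast not_lt.mp hn
  have hx : (⟨√b, 0, 1, 0⟩ : ℍ[ℝ, algebraMap ℚ ℝ a, algebraMap ℚ ℝ b]) ≠ 0 := fun h0 ↦ by
    simpa using congrArg QuaternionAlgebra.imJ h0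
  have h0 := (h _ hx).mul_right_eq_zero (b := ⟨√b, 0, -1, 0⟩)
  have := congrArg QuaternionAlgebra.imJ (h0.mp (by
    ext <;> simp [Real.mul_self_sqrt hb0]))
  simp at this

theorem nrd_nonneg (ha : a < 0) (hb : b < 0) (x : ℍ[ℚ, a, b]) : 0 ≤ nrd x := by
  rw [nrd_eq]
  nlinarith [sq_nonneg x.re, mul_nonneg (neg_pos.2 ha).le (sq_nonneg x.imI),
    mul_nonneg (neg_pos.2 hb).le (sq_nonneg x.imJ),
    mul_nonneg (mul_pos_of_neg_of_neg ha hb).le (sq_nonneg x.imK)]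

theorem nrd_pos (ha : a < 0) (hb : b < 0) {x : ℍ[ℚ, a, b]} (hx : x ≠ 0) : 0 < nrd x := by
  refine (nrd_nonneg ha hb x).lt_of_ne' fun h ↦ hx ?_
  rw [nrd_eq] at h
  have hab := mul_pos_of_neg_of_neg ha hb
  have h1 := sq_nonneg x.re
  have h2 := mul_nonneg (neg_pos.2 ha).le (sq_nonneg x.imI)
  have h3 := mul_nonneg (neg_pos.2 hb).le (sq_nonneg x.imJ)
  have h4 := mul_nonneg hab.le (sq_nonneg x.imK)
  have e1 : x.re ^ 2 = 0 := by linarith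
  have e2 : -a * x.imI ^ 2 = 0 := by linarith
  have e3 : -b * x.imJ ^ 2 = 0 := by linarith
  have e4 : a * b * x.imK ^ 2 = 0 := by linarith
  simp only [mul_eq_zero, neg_eq_zero, ha.ne, hb.ne, false_or, or_self,
    pow_eq_zero_iff two_ne_zero] at e1 e2 e3 e4
  ext <;> simp [*]

/-- With `x₀`, `y₀` the trace-zero parts, `nrd [x, y] = 4 nrd x₀ nrd y₀ - (tr x₀ y₀)²`. -/
theorem nrd_commutator_le (ha : a < 0) (hb : b < 0) (x y : ℍ[ℚ, a, b]) :
    nrd (x * y - y * x) ≤ 4 * (nrd x * nrd y) := by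
  have hx : nrd x = x.re ^ 2 + nrd x.im := by simp [nrd_eq]; ring
  have hy : nrd y = y.re ^ 2 + nrd y.im := by simp [nrd_eq]; ring
  have key : nrd (x * y - y * x) =
      4 * (nrd x.im * nrd y.im) - (2 * (x.im * y.im).re) ^ 2 := by
    simp [nrd_eq]
    ring
  have h1 := nrd_nonneg ha hb x.im
  have h2 := nrd_nonneg ha hb y.im
  rw [key, hx, hy]
  nlinarith [sq_nonneg (2 * (x.im * y.im).re), mul_nonneg (sq_nonneg x.re) (sq_nonneg y.re),
    mul_nonneg (sq_nonneg x.re) h2, mul_nonneg h1 (sq_nonneg y.re)]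

/-! ### Commuting elements -/

/-- The centralizer of a non-rational element is the subfield it generates. -/
theorem mem_adjoin_of_commute (ha : a ≠ 0) (hb : b ≠ 0) {x y : ℍ[ℚ, a, b]} (h : x * y = y * x)
    (hx : ∀ q : ℚ, x ≠ q) : y ∈ Algebra.adjoin ℚ {x} := by
  have h1 := congrArg QuaternionAlgebra.imI h
  have h2 := congrArg QuaternionAlgebra.imJ h
  have h3 := congrArg QuaternionAlgebra.imK h
  simp only [QuaternionAlgebra.imI_mul, QuaternionAlgebra.imJ_mul,
    QuaternionAlgebra.imK_mul] at h1 h2 h3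
  have e1 : x.imJ * y.imK = x.imK * y.imJ := mul_left_cancel₀ hb (by linarith)
  have e2 : x.imI * y.imK = x.imK * y.imI := mul_left_cancel₀ ha (by linarith)
  have e3 : x.imI * y.imJ = x.imJ * y.imI := by linarith
  obtain ⟨s, hs1, hs2, hs3⟩ : ∃ s : ℚ, y.imI = s * x.imI ∧ y.imJ = s * x.imJ ∧
      y.imK = s * x.imK := by
    by_cases hi : x.imI = 0
    · by_cases hj : x.imJ = 0
      · have hk : x.imK ≠ 0 := fun hk ↦ hx x.re (by ext <;> simp [hi, hj, hk])
        refine ⟨y.imK / x.imK, ?_, ?_, ?_⟩ <;> field_simp <;> linarith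
      · refine ⟨y.imJ / x.imJ, ?_, ?_, ?_⟩ <;> field_simp <;> linarith
    · refine ⟨y.imI / x.imI, ?_, ?_, ?_⟩ <;> field_simp <;> linarith
  have hy : y = algebraMap ℚ _ (y.re - s * x.re) + s • x := by
    ext <;> simp [hs1, hs2, hs3]
  rw [hy]
  exact add_mem (Subalgebra.algebraMap_mem _ _)
    (Subalgebra.smul_mem _ (Algebra.self_mem_adjoin_singleton ℚ x) s)

theorem adjoin_eq_of_commute (ha : a ≠ 0) (hb : b ≠ 0) {x y : ℍ[ℚ, a, b]} (h : x * y = y * x)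
    (hx : ∀ q : ℚ, x ≠ q) (hy : ∀ q : ℚ, y ≠ q) :
    Algebra.adjoin ℚ {x} = Algebra.adjoin ℚ {y} :=
  le_antisymm
    (Algebra.adjoin_le (Set.singleton_subset_iff.2 (mem_adjoin_of_commute ha hb h.symm hy)))
    (Algebra.adjoin_le (Set.singleton_subset_iff.2 (mem_adjoin_of_commute ha hb h hx)))

/-! ### Orders -/

theorem IsOrder.module_finite {O : Subring ℍ[ℚ, a, b]} (h : IsOrder O) : Module.Finite ℤ O := by
  obtain ⟨e, he⟩ := h
  have : AddGroup.FG O.toAddSubgroup := by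
    rw [← he]
    infer_instance
  exact Module.Finite.iff_addGroup_fg.mpr this

theorem IsOrder.isIntegral {O : Subring ℍ[ℚ, a, b]} (h : IsOrder O) {x : ℍ[ℚ, a, b]}
    (hx : x ∈ O) : IsIntegral ℤ x := by
  have := h.module_finite
  exact map_isIntegral_int O.subtype (Algebra.IsIntegral.isIntegral (R := ℤ) (⟨x, hx⟩ : O))

theorem isIntegral_star {x : ℍ[ℚ, a, b]} (h : IsIntegral ℤ x) : IsIntegral ℤ (star x) := by
  obtain ⟨f, hf, h0⟩ := h
  refine ⟨f, hf, ?_⟩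
  rw [eval₂_eq_sum_range] at h0 ⊢
  simpa [Int.cast_comm] using congrArg star h0

theorem isIntegral_ratCast {q : ℚ} (h : IsIntegral ℤ (q : ℍ[ℚ, a, b])) : ∃ m : ℤ, q = m := by
  have hq : IsIntegral ℤ q :=
    (isIntegral_algebraMap_iff (B := ℍ[ℚ, a, b]) (algebraMap ℚ _).injective).1 h
  obtain ⟨m, hm⟩ := IsIntegrallyClosed.isIntegral_iff.1 hq
  exact ⟨m, by simpa using hm.symm⟩

open scoped IsMulCommutative in
theorem exists_int_nrd {x : ℍ[ℚ, a, b]} (h : IsIntegral ℤ x) : ∃ m : ℤ, nrd x = m := by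
  refine isIntegral_ratCast (a := a) (b := b) ?_
  -- `x` and `star x` commute, so the product can be taken in the commutative ring they generate.
  have hc : x * star x = star x * x := by ext <;> simp <;> ring
  let S := Algebra.adjoin ℤ {x, star x}
  have : IsMulCommutative S :=
    Algebra.isMulCommutative_adjoin ℤ (by
      rintro u (rfl | rfl) v (rfl | rfl) <;> first | rfl | exact hc | exact hc.symm)
  have h1 : IsIntegral ℤ (⟨x, Algebra.subset_adjoin (by simp)⟩ : S) :=
    (isIntegral_algHom_iff S.val Subtype.val_injective).1 h
  have h2 : IsIntegral ℤ (⟨star x, Algebra.subset_adjoin (by simp)⟩ : S) :=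
    (isIntegral_algHom_iff S.val Subtype.val_injective).1 (isIntegral_star h)
  rw [coe_nrd]
  exact (h1.mul h2).map S.val

theorem IsOrder.exists_int_nrd {O : Subring ℍ[ℚ, a, b]} (h : IsOrder O) {x : ℍ[ℚ, a, b]}
    (hx : x ∈ O) : ∃ m : ℤ, nrd x = m :=
  QuatOrder.exists_int_nrd (h.isIntegral hx)

theorem IsOrder.ne_ratCast {O : Subring ℍ[ℚ, a, b]} (h : IsOrder O) {x : ℍ[ℚ, a, b]}
    (hx : x ∈ O) (hn : ∀ n : ℤ, x ≠ n) (q : ℚ) : x ≠ q := by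
  rintro rfl
  obtain ⟨m, rfl⟩ := isIntegral_ratCast (h.isIntegral hx)
  exact hn m (by ext <;> simp)

theorem IsOrder.exists_nsmul_mem {O : Subring ℍ[ℚ, a, b]} (h : IsOrder O) (x : ℍ[ℚ, a, b]) :
    ∃ n : ℕ, n ≠ 0 ∧ n • x ∈ O := by
  obtain ⟨e, he⟩ := h
  have hO : ∀ i, e i ∈ O.toAddSubgroup := fun i ↦ he ▸ AddSubgroup.subset_closure ⟨i, rfl⟩
  refine ⟨∏ i, (e.repr x i).den, Finset.prod_ne_zero_iff.2 fun i _ ↦ (e.repr x i).den_nz, ?_⟩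
  have hx : (∏ i, (e.repr x i).den) • x =
      ∑ j, (∏ i, (e.repr x i).den) • (e.repr x j • e j) := by
    rw [← Finset.smul_sum, e.sum_repr]
  rw [hx]
  refine sum_mem fun i _ ↦ ?_
  obtain ⟨k, hk⟩ := Finset.dvd_prod_of_mem (fun i ↦ (e.repr x i).den) (Finset.mem_univ i)
  have : (∏ i, (e.repr x i).den) • (e.repr x i • e i) = (k * (e.repr x i).num) • e i := by
    rw [hk, ← Nat.cast_smul_eq_nsmul ℚ, ← Int.cast_smul_eq_zsmul ℚ, smul_smul]
    congr 1
    push_cast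
    rw [mul_right_comm, Rat.den_mul_eq_num, mul_comm]
  rw [this]
  exact zsmul_mem (hO i) _

theorem dist_ne_zero {O O' : Subring ℍ[ℚ, a, b]} (h : IsOrder O) (h' : IsOrder O') :
    dist O O' ≠ 0 := by
  have := h.module_finite
  let H := (O ⊓ O').toAddSubgroup.addSubgroupOf O.toAddSubgroup
  have hfg : AddGroup.FG O.toAddSubgroup := Module.Finite.iff_addGroup_fg.mp h.module_finite
  have : Finite (O.toAddSubgroup ⧸ H) := by
    have : Module.Finite ℤ (O.toAddSubgroup ⧸ H) := Module.Finite.iff_addGroup_fg.mpr inferInstance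
    refine Module.finite_of_fg_torsion _ fun y ↦ ?_
    induction y using QuotientAddGroup.induction_on with | _ x
    obtain ⟨n, hn, hx⟩ := h'.exists_nsmul_mem (x : ℍ[ℚ, a, b])
    refine ⟨⟨n, mem_nonZeroDivisors_of_ne_zero (by exact_mod_cast hn)⟩, ?_⟩
    change ((n : ℤ) • (x : O.toAddSubgroup ⧸ H)) = 0
    rw [natCast_zsmul, ← QuotientAddGroup.mk_nsmul, QuotientAddGroup.eq_zero_iff]
    exact ⟨nsmul_mem x.2 n, hx⟩
  have : H.FiniteIndex := AddSubgroup.finiteIndex_of_finite_quotient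
  exact AddSubgroup.FiniteIndex.index_ne_zero (H := H)

theorem dist_nsmul_mem {O O' : Subring ℍ[ℚ, a, b]} {x : ℍ[ℚ, a, b]} (hx : x ∈ O) :
    dist O O' • x ∈ O' :=
  (((O ⊓ O').toAddSubgroup.addSubgroupOf O.toAddSubgroup).nsmul_index_mem ⟨x, hx⟩ :).2

/-! ### Ramification at `p` -/

variable {p : ℕ} [Fact p.Prime]

/-- If `p` divided the norm of `z` but not its trace, then by Hensel's lemma the polynomial
`X² - trd z X + nrd z` would have a root `r` in `ℤ_p`, and `z - r` would be a zero divisor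
over `ℚ_p`. -/
theorem RamifiedOver.dvd_trd (h : RamifiedOver ℚ_[p] a b) {z : ℍ[ℚ, a, b]} {t m : ℤ}
    (ht : 2 * z.re = t) (hm : nrd z = m) (hp : (p : ℤ) ∣ m) : (p : ℤ) ∣ t := by
  by_contra hpt
  have hpt' : ‖(t : ℤ_[p])‖ = 1 := by
    refine le_antisymm (PadicInt.norm_le_one _) (not_lt.1 ?_)
    rwa [PadicInt.norm_int_lt_one_iff_dvd]
  -- At `0` the polynomial has value `m`, divisible by `p`, and derivative `-t`, a unit.
  obtain ⟨r, hr, -⟩ := hensels_lemma (p := p) (R := ℤ_[p])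
    (F := X ^ 2 - C (t : ℤ_[p]) * X + C (m : ℤ_[p])) (a := 0)
    (by simpa [hpt'] using (PadicInt.norm_int_lt_one_iff_dvd (p := p) m).2 hp)
  replace hr : (r : ℚ_[p]) ^ 2 - t * r + m = 0 := by
    have := congrArg (fun x : ℤ_[p] ↦ (x : ℚ_[p])) hr
    simpa using this
  let w : ℍ[ℚ_[p], algebraMap ℚ ℚ_[p] a, algebraMap ℚ ℚ_[p] b] := ⟨z.re - r, z.imI, z.imJ, z.imK⟩
  have hw : w * star w = 0 := by
    have ht' : (2 * z.re : ℚ_[p]) = t := by exact_mod_cast congrArg (fun q : ℚ ↦ (q : ℚ_[p])) ht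
    have hm' : (z.re ^ 2 - a * z.imI ^ 2 - b * z.imJ ^ 2 + a * b * z.imK ^ 2 : ℚ_[p]) = m := by
      rw [nrd_eq] at hm
      exact_mod_cast congrArg (fun q : ℚ ↦ (q : ℚ_[p])) hm
    rw [← ht', ← hm'] at hr
    ext
    · simp [w]
      linear_combination hr
    all_goals simp [w]; ring
  have hw0 : w = 0 := by
    by_contra hne
    exact hne (star_eq_zero.1 ((h w hne).mul_right_eq_zero.1 hw))
  -- So `z` equals `r` and is rational; then `t² = 4 m`, which still contradicts `p ∤ t`.
  have hi : z.imI = 0 := by simpa [w] using congrArg QuaternionAlgebra.imI hw0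
  have hj : z.imJ = 0 := by simpa [w] using congrArg QuaternionAlgebra.imJ hw0
  have hk : z.imK = 0 := by simpa [w] using congrArg QuaternionAlgebra.imK hw0
  have htm : t ^ 2 = 4 * m := by
    have : (t : ℚ) ^ 2 = 4 * m := by
      rw [← ht, ← hm, nrd_eq, hi, hj, hk]
      ring
    exact_mod_cast this
  exact hpt ((Nat.prime_iff_prime_int.1 Fact.out).dvd_of_dvd_pow (htm ▸ hp.mul_left 4))

/-- The elements of an order whose norm is divisible by `p`: the intersection of the order with
the maximal ideal of the valuation ring of the division algebra over `ℚ_p`. -/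
def normIdeal (h : RamifiedOver ℚ_[p] a b) {O : Subring ℍ[ℚ, a, b]} (hO : IsOrder O) : Ideal O where
  carrier := {x | ∃ m : ℤ, nrd (x : ℍ[ℚ, a, b]) = (p * m : ℤ)}
  zero_mem' := ⟨0, by simp [nrd_eq]⟩
  add_mem' := by
    rintro x y ⟨m, hm⟩ ⟨k, hk⟩
    obtain ⟨l, hl⟩ := hO.exists_int_nrd (x + y).2
    have ht : 2 * ((x : ℍ[ℚ, a, b]) * star (y : ℍ[ℚ, a, b])).re = (l - p * m - p * k : ℤ) := by
      rw [Subring.coe_add, nrd_add, hm, hk] at hl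
      push_cast at hl ⊢
      linarith
    obtain ⟨d, hd⟩ := h.dvd_trd (m := p * m * (p * k)) ht
      (by rw [nrd_mul, nrd_star, hm, hk]; push_cast; rfl) ⟨m * (p * k), by ring⟩
    refine ⟨m + k + d, ?_⟩
    rw [hl]
    congr 1
    linear_combination hd
  smul_mem' := by
    rintro c x ⟨m, hm⟩
    obtain ⟨l, hl⟩ := hO.exists_int_nrd c.2
    refine ⟨l * m, ?_⟩
    rw [smul_eq_mul, Subring.coe_mul, nrd_mul, hl, hm]
    push_cast
    ring

theorem mem_normIdeal (h : RamifiedOver ℚ_[p] a b) {O : Subring ℍ[ℚ, a, b]} (hO : IsOrder O)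
    {x : O} : x ∈ normIdeal h hO ↔ ∃ m : ℤ, nrd (x : ℍ[ℚ, a, b]) = (p * m : ℤ) :=
  Iff.rfl

instance (h : RamifiedOver ℚ_[p] a b) {O : Subring ℍ[ℚ, a, b]} (hO : IsOrder O) :
    (normIdeal h hO).IsTwoSided where
  mul_mem_of_left := by
    rintro x c ⟨m, hm⟩
    obtain ⟨l, hl⟩ := hO.exists_int_nrd c.2
    refine ⟨m * l, ?_⟩
    rw [Subring.coe_mul, nrd_mul, hl, hm]
    push_cast
    ring

theorem isDomain_quotient_normIdeal (h : RamifiedOver ℚ_[p] a b) {O : Subring ℍ[ℚ, a, b]}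
    (hO : IsOrder O) : IsDomain (O ⧸ normIdeal h hO) := by
  have hp : Prime (p : ℤ) := Nat.prime_iff_prime_int.1 Fact.out
  have : Nontrivial (O ⧸ normIdeal h hO) := by
    refine Ideal.Quotient.nontrivial_iff.2 fun htop ↦ ?_
    obtain ⟨m, hm⟩ := (Ideal.eq_top_iff_one _).1 htop
    rw [Subring.coe_one, nrd_one] at hm
    exact hp.not_isUnit (IsUnit.of_mul_eq_one m (by exact_mod_cast hm.symm))
  have : NoZeroDivisors (O ⧸ normIdeal h hO) := by
    refine ⟨fun {u v} huv ↦ ?_⟩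
    obtain ⟨x, rfl⟩ := Ideal.Quotient.mk_surjective u
    obtain ⟨y, rfl⟩ := Ideal.Quotient.mk_surjective v
    rw [← map_mul, Ideal.Quotient.eq_zero_iff_mem] at huv
    rw [Ideal.Quotient.eq_zero_iff_mem, Ideal.Quotient.eq_zero_iff_mem]
    obtain ⟨m, hm⟩ := huv
    obtain ⟨k, hk⟩ := hO.exists_int_nrd x.2
    obtain ⟨l, hl⟩ := hO.exists_int_nrd y.2
    rw [Subring.coe_mul, nrd_mul, hk, hl] at hm
    refine (hp.dvd_or_dvd ⟨m, by exact_mod_cast hm⟩).imp ?_ ?_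
    · rintro ⟨d, rfl⟩
      exact ⟨d, hk⟩
    · rintro ⟨d, rfl⟩
      exact ⟨d, hl⟩
  exact NoZeroDivisors.to_isDomain _

theorem finite_quotient_normIdeal (h : RamifiedOver ℚ_[p] a b) {O : Subring ℍ[ℚ, a, b]}
    (hO : IsOrder O) : Finite (O ⧸ normIdeal h hO) := by
  have := hO.module_finite
  have : Module.Finite ℤ (O ⧸ normIdeal h hO) :=
    Module.Finite.of_surjective (Ideal.Quotient.mk (normIdeal h hO)).toAddMonoidHom.toIntLinearMap
      Ideal.Quotient.mk_surjective
  refine Module.finite_of_fg_torsion _ fun y ↦ ?_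
  obtain ⟨x, rfl⟩ := Ideal.Quotient.mk_surjective y
  refine ⟨⟨p, mem_nonZeroDivisors_of_ne_zero (by exact_mod_cast NeZero.ne p)⟩, ?_⟩
  change (p : ℤ) • Ideal.Quotient.mk (normIdeal h hO) x = 0
  rw [natCast_zsmul, ← map_nsmul, Ideal.Quotient.eq_zero_iff_mem]
  obtain ⟨k, hk⟩ := hO.exists_int_nrd x.2
  refine ⟨p * k, ?_⟩
  rw [show ((p • x : O) : ℍ[ℚ, a, b]) = p • (x : ℍ[ℚ, a, b]) from rfl, nrd_nsmul, hk]
  push_cast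
  ring

/-- The quotient of an order by its ideal of elements of norm divisible by `p` is a finite domain,
so it is commutative by Wedderburn's theorem. -/
theorem IsOrder.dvd_nrd_commutator (h : RamifiedOver ℚ_[p] a b) {O : Subring ℍ[ℚ, a, b]}
    (hO : IsOrder O) {x y : ℍ[ℚ, a, b]} (hx : x ∈ O) (hy : y ∈ O) :
    ∃ m : ℤ, nrd (x * y - y * x) = (p * m : ℤ) := by
  have := isDomain_quotient_normIdeal h hO
  have := finite_quotient_normIdeal h hO
  have hc := (Finite.isDomain_to_isField (O ⧸ normIdeal h hO)).mul_comm
    (Ideal.Quotient.mk _ ⟨x, hx⟩) (Ideal.Quotient.mk _ ⟨y, hy⟩)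
  rw [← map_mul, ← map_mul, Ideal.Quotient.eq] at hc
  exact (mem_normIdeal h hO).1 hc

/-- The product of the norms of two non-commuting elements of an order is at least `p / 4`. -/
theorem IsOrder.le_four_mul_nrd_mul_nrd (hB : RamifiedExactlyAt p a b) {O : Subring ℍ[ℚ, a, b]}
    (hO : IsOrder O) {x y : ℍ[ℚ, a, b]} (hx : x ∈ O) (hy : y ∈ O) (hxy : x * y ≠ y * x) :
    (p : ℚ) ≤ 4 * (nrd x * nrd y) := by
  have ha := hB.real.left_neg
  have hb := hB.real.right_neg
  refine le_trans ?_ (nrd_commutator_le ha hb x y)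
  have hpos := nrd_pos ha hb (sub_ne_zero.2 hxy)
  obtain ⟨m, hm⟩ := hO.dvd_nrd_commutator hB.padic hx hy
  rw [hm] at hpos ⊢
  exact_mod_cast Int.le_of_dvd (by exact_mod_cast hpos) (dvd_mul_right (p : ℤ) m)

end QuatOrder

/-! ### The distance bound -/

theorem proposition4p4 (p : ℕ) [Fact p.Prime] (a b : ℚ) (hB : QuatOrder.RamifiedExactlyAt p a b)
    (O O' : Subring ℍ[ℚ, a, b])
    (hO : QuatOrder.IsMaximalOrder O) (hO' : QuatOrder.IsMaximalOrder O')
    (M : ℝ) (α α' : ℍ[ℚ, a, b]) (hα : α ∈ O) (hα' : α' ∈ O')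
    (hαint : ∀ n : ℤ, α ≠ (n : ℍ[ℚ, a, b])) (hαint' : ∀ n : ℤ, α' ≠ (n : ℍ[ℚ, a, b]))
    (hM : (QuatOrder.nrd α : ℝ) ≤ M) (hM' : (QuatOrder.nrd α' : ℝ) ≤ M)
    (hfields : IsEmpty (Algebra.adjoin ℚ {α} ≃ₐ[ℚ] Algebra.adjoin ℚ {α'})) :
    (p : ℝ) / (4 * M ^ 2) ≤ (QuatOrder.dist O O' : ℝ) ^ 2 := by
  have ha := hB.real.left_neg
  have hb := hB.real.right_neg
  have hN : (QuatOrder.dist O O' : ℚ) ≠ 0 := by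
    exact_mod_cast QuatOrder.dist_ne_zero hO.prop hO'.prop
  have hne : α * α' ≠ α' * α := fun h ↦ hfields.elim <| Subalgebra.equivOfEq _ _ <|
    QuatOrder.adjoin_eq_of_commute ha.ne hb.ne h (hO.prop.ne_ratCast hα hαint)
      (hO'.prop.ne_ratCast hα' hαint')
  have hne' : (QuatOrder.dist O O' • α) * α' ≠ α' * (QuatOrder.dist O O' • α) := by
    rw [← Nat.cast_smul_eq_nsmul ℚ, smul_mul_assoc, mul_smul_comm]
    exact fun h ↦ hne (smul_right_injective _ hN h)
  have key := hO'.prop.le_four_mul_nrd_mul_nrd hB (QuatOrder.dist_nsmul_mem hα) hα' hne'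
  rw [QuatOrder.nrd_nsmul] at key
  have key' : (p : ℝ) ≤ 4 * ((QuatOrder.dist O O' : ℝ) ^ 2 * QuatOrder.nrd α *
      QuatOrder.nrd α') := by exact_mod_cast key
  have h0 : (0 : ℝ) < QuatOrder.nrd α := by
    exact_mod_cast QuatOrder.nrd_pos ha hb fun h ↦ hαint 0 (by simpa using h)
  have h0' : (0 : ℝ) ≤ QuatOrder.nrd α' := by exact_mod_cast QuatOrder.nrd_nonneg ha hb α'
  have hMpos : 0 < M := h0.trans_le hM
  rw [div_le_iff₀ (by positivity)]
  have := mul_le_mul hM hM' h0' hMpos.le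
  nlinarith [mul_le_mul_of_nonneg_left this (sq_nonneg (QuatOrder.dist O O' : ℝ))]
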